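/- Let $PW^2$ be the space of entire functions $g:\mathbb{C}\to\mathbb{C}$ of exponential type at most $\pi$ (that is, for every $\varepsilon>0$ there is $C_\varepsilon>0$ with $|g(z)|\le C_\varepsilon e^{(\pi+\varepsilon)|z|}$ for all $z\in\mathbb{C}$) whose restriction to $\mathbb{R}$ belongs to $L^2(\mathbb{R})$. Fix $a>0$. Then for every $g\in PW^2$ with $g(0)=1$ the function $|g|^2+a|g'|^2$ is integrable on $\mathbb{R}$ and $$ \frac{\pi\sqrt a}{\arctan(\pi\sqrt a)}\;\le\;\int_{-\infty}^{\infty}\left(|g(x)|^2+a\,|g'(x)|^2\right)dx . $$ Moreover, the function $$ g_a(z)=\frac{\pi\sqrt a}{\arctan(\pi\sqrt a)}\int_0^1\frac{\cos(\pi z t)}{1+a\pi^2t^2}\,dt $$ belongs to $PW^2$ and satisfies $g_a(0)=1$, and it is the unique extremal function: for $g\in PW^2$ with $g(0)=1$, equality holds in the above inequality if and only if $g=g_a$. -/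

import Mathlib

open MeasureTheory

/-- `G` has exponential type at most `τ`: for every `ε > 0` there is `C > 0` such that
`|G z| ≤ C * exp ((τ + ε) * |z|)` for all complex `z`. -/
def ExpTypeAtMost (τ : ℝ) (G : ℂ → ℂ) : Prop :=
  ∀ ε : ℝ, 0 < ε → ∃ C : ℝ, 0 < C ∧ ∀ z : ℂ, ‖G z‖ ≤ C * Real.exp ((τ + ε) * ‖z‖)

/-- The Paley-Wiener space `PW²`: entire functions of exponential type at most `π` whose
restriction to the real line is square integrable. -/
def PW2 : Set (ℂ → ℂ) :=
  {g | Differentiable ℂ g ∧ ExpTypeAtMost Real.pi g ∧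
    MemLp (fun x : ℝ => g (x : ℂ)) 2 volume}

/-- The constant `π √a / arctan (π √a)`. -/
noncomputable def sharpConst (a : ℝ) : ℝ :=
  Real.pi * Real.sqrt a / Real.arctan (Real.pi * Real.sqrt a)

/-- The function
`z ↦ (π √a / arctan (π √a)) * ∫ t in 0..1, cos (π z t) / (1 + a π² t²)`. -/
noncomputable def extremalFun (a : ℝ) (z : ℂ) : ℂ :=
  (sharpConst a : ℂ) *
    ∫ t in (0 : ℝ)..1,
      Complex.cos ((Real.pi : ℂ) * z * (t : ℂ)) /
        (1 + (a : ℂ) * (Real.pi : ℂ) ^ 2 * (t : ℂ) ^ 2)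

/-! For `a > 0` the energy is the squared norm of a weighted Sobolev-type inner product on `PW2`,
and the question is the least norm given the value at `0`. Evaluation at `0` is represented by `K =
evalKernel a`, whose frequency density on the band is `1 / (1 + a π² t²)`. Indeed `K - a K'' = sinc
(π x)`, so integrating by parts turns the pairing of `f` with `K` into `∫ f x * sinc (π x) = f 0`.
Since `K 0 = 1 / C` with `C = sharpConst a`, expanding the square for `g 0 = 1` gives energy of `g -
C K` = energy of `g` minus `C`. This yields the inequality and the equality case together.

The analytic input avoids the Fourier transform. `memLp_deriv_of_mem_PW2` follows from
Phragmén–Lindelöf applied to a correlation of `f`, and the sinc identity (`integral_mul_sinc`) from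
half-disc contour integrals, first at frequencies above `π`. -/

open Filter Topology Set

/-! ### Growth off the real axis -/

/-- **Phragmén–Lindelöf** for functions of exponential type bounded on the real line, in the
closed upper half-plane. -/
theorem ExpTypeAtMost.norm_le_of_im_nonneg {τ σ M : ℝ} {G : ℂ → ℂ} (hG : Differentiable ℂ G)
    (hτ : ExpTypeAtMost τ G) (hM : ∀ x : ℝ, ‖G x‖ ≤ M) (hσ : τ < σ) {z : ℂ} (hz : 0 ≤ z.im) :
    ‖G z‖ ≤ M * Real.exp (σ * z.im) := by
  obtain ⟨C, hC, hGC⟩ := hτ (σ - τ) (by linarith)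
  simp only [add_sub_cancel] at hGC
  have hnorm (w : ℂ) : ‖G (Complex.I * w) * Complex.exp (-σ * w)‖ =
      ‖G (Complex.I * w)‖ * Real.exp (-σ * w.re) := by
    simp [Complex.norm_exp]
  -- The rotation `w ↦ I * w` carries the right half-plane to the upper one. The factor `exp (-σ w)`
  -- has modulus 1 on the imaginary axis and cancels the growth `exp (σ |w|)` on the positive real
  -- axis.
  have key := PhragmenLindelof.right_half_plane_of_bounded_on_real (C := M)
    (f := fun w => G (Complex.I * w) * Complex.exp (-σ * w)) (z := -Complex.I * z) ?_ ?_ ?_ ?_ ?_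
  · rw [hnorm] at key
    have e1 : Complex.I * (-Complex.I * z) = z := by
      rw [← mul_assoc]; simp
    have e2 : (-Complex.I * z).re = z.im := by simp
    rw [e1, e2] at key
    calc ‖G z‖ = ‖G z‖ * Real.exp (-σ * z.im) * Real.exp (σ * z.im) := by
          rw [mul_assoc, ← Real.exp_add]; simp
      _ ≤ _ := by gcongr
  · exact (Differentiable.mul (by fun_prop) (by fun_prop)).diffContOnCl
  · refine ⟨1, by norm_num, 2 * |σ|, Asymptotics.IsBigO.of_bound C ?_⟩
    refine Eventually.of_forall fun w => ?_
    rw [hnorm, Real.norm_of_nonneg (Real.exp_pos _).le, Real.rpow_one]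
    have h1 := hGC (Complex.I * w)
    simp only [norm_mul, Complex.norm_I, one_mul] at h1
    calc _ ≤ C * Real.exp (σ * ‖w‖) * Real.exp (-σ * w.re) := by gcongr
      _ = C * Real.exp (σ * ‖w‖ + -σ * w.re) := by rw [mul_assoc, ← Real.exp_add]
      _ ≤ _ := by
        gcongr
        have h2 : σ * ‖w‖ ≤ |σ| * ‖w‖ := by gcongr; exact le_abs_self _
        have h3 : -σ * w.re ≤ |σ| * ‖w‖ := by
          refine (le_abs_self _).trans ?_
          rw [abs_mul, abs_neg]
          gcongr
          exact Complex.abs_re_le_norm w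
        linarith
  · refine isBoundedUnder_of_eventually_le (a := C) ?_
    filter_upwards [eventually_ge_atTop 0] with x hx
    rw [hnorm]
    have h1 := hGC (Complex.I * x)
    simp only [norm_mul, Complex.norm_I, one_mul, Complex.norm_real, Real.norm_of_nonneg hx] at h1
    calc _ ≤ C * Real.exp (σ * x) * Real.exp (-σ * x) := by
          rw [Complex.ofReal_re]; gcongr
      _ = C := by rw [mul_assoc, ← Real.exp_add]; simp
  · intro x
    have e1 : Complex.I * (x * Complex.I) = ((-x : ℝ) : ℂ) := by
      rw [mul_left_comm]; simp
    rw [hnorm, e1]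
    simpa using hM (-x)
  · simpa using hz

theorem ExpTypeAtMost.comp_neg {τ : ℝ} {G : ℂ → ℂ} (h : ExpTypeAtMost τ G) :
    ExpTypeAtMost τ (fun z => G (-z)) := fun ε hε => by
  obtain ⟨C, hC, hGC⟩ := h ε hε
  exact ⟨C, hC, fun z => by simpa using hGC (-z)⟩

/-- **Phragmén–Lindelöf** for functions of exponential type bounded on the real line. -/
theorem ExpTypeAtMost.norm_le_of_bounded_on_real {τ σ M : ℝ} {G : ℂ → ℂ}
    (hG : Differentiable ℂ G) (hτ : ExpTypeAtMost τ G) (hM : ∀ x : ℝ, ‖G x‖ ≤ M) (hσ : τ < σ)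
    (z : ℂ) : ‖G z‖ ≤ M * Real.exp (σ * |z.im|) := by
  rcases le_total 0 z.im with hz | hz
  · rw [abs_of_nonneg hz]
    exact hτ.norm_le_of_im_nonneg hG hM hσ hz
  · rw [abs_of_nonpos hz]
    have := hτ.comp_neg.norm_le_of_im_nonneg (z := -z) (hG.comp differentiable_neg)
      (fun x => by simpa using hM (-x)) hσ (by simpa using hz)
    simpa using this

/-! ### Square integrability of the derivative and boundedness on the line -/

/-- Differentiation under the integral sign over a compact interval, for a jointly continuous
derivative. -/
theorem hasDerivAt_intervalIntegral_of_continuous {Φ Φ' : ℂ → ℝ → ℂ} (a b : ℝ)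
    (hΦ : ∀ z, Continuous (Φ z)) (hΦ' : Continuous (Function.uncurry Φ'))
    (h : ∀ z t, HasDerivAt (fun w => Φ w t) (Φ' z t) z) (z : ℂ) :
    HasDerivAt (fun w => ∫ t in a..b, Φ w t) (∫ t in a..b, Φ' z t) z := by
  obtain ⟨K, hK⟩ := ((isCompact_closedBall z 1).prod (isCompact_uIcc (a := a) (b := b))).exists_bound_of_continuousOn
    hΦ'.continuousOn
  refine (intervalIntegral.hasDerivAt_integral_of_dominated_loc_of_deriv_le
    (s := Metric.closedBall z 1) (bound := fun _ => K)
    (Metric.closedBall_mem_nhds z one_pos)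
    (Eventually.of_forall fun w => (hΦ w).aestronglyMeasurable)
    ((hΦ z).intervalIntegrable _ _)
    (Continuous.aestronglyMeasurable (hΦ'.comp (by fun_prop : Continuous fun t : ℝ => (z, t))))
    (ae_of_all _ fun t ht w hw => hK (w, t) ⟨hw, uIoc_subset_uIcc ht⟩)
    intervalIntegrable_const (ae_of_all _ fun t _ w _ => h w t)).2

theorem Differentiable.memLp_two_iff {f : ℂ → ℂ} (hf : Differentiable ℂ f) :
    MemLp (fun x : ℝ => f x) 2 volume ↔ Integrable (fun x : ℝ => ‖f x‖ ^ 2) volume :=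
  memLp_two_iff_integrable_sq_norm
    (hf.continuous.comp Complex.continuous_ofReal).aestronglyMeasurable

/-- The pairing of `f'` with a truncated continuous function is controlled by the `L²` norms: it is
the derivative at `0` of a correlation that has exponential type and is bounded on the real line. -/
theorem norm_integral_deriv_mul_le {f : ℂ → ℂ} (hf : f ∈ PW2) {ψ : ℝ → ℂ} (hψ : Continuous ψ)
    {N l : ℝ} (hN : 0 ≤ N) (hl : 0 < l) :
    ‖∫ t in (-N)..N, deriv f t * ψ t‖ ≤ Real.exp (Real.pi + 1) *
      ((l * ∫ x : ℝ, ‖f x‖ ^ 2) + (∫ t in (-N)..N, ‖ψ t‖ ^ 2) / l) / 2 := by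
  obtain ⟨hd, hτ, hL⟩ := hf
  have hN' : -N ≤ N := by linarith
  have hfc := hd.continuous
  have hfc' : Continuous (deriv f) := hd.deriv.continuous
  set G : ℂ → ℂ := fun z => ∫ t in (-N)..N, f (z + t) * ψ t with hGdef
  have hG' (z : ℂ) : HasDerivAt G (∫ t in (-N)..N, deriv f (z + t) * ψ t) z := by
    refine hasDerivAt_intervalIntegral_of_continuous
      (Φ := fun z t => f (z + t) * ψ t) (Φ' := fun z t => deriv f (z + t) * ψ t) _ _
      (fun z => by fun_prop)
      (by simp only [Function.uncurry_def]; fun_prop) (fun z t => ?_) z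
    exact ((hd (z + t)).hasDerivAt.comp_add_const z t).mul_const _
  have hGd : Differentiable ℂ G := fun z => (hG' z).differentiableAt
  have hGτ : ExpTypeAtMost Real.pi G := fun ε hε => by
    obtain ⟨C, hC, hfC⟩ := hτ ε hε
    have hpe : 0 < Real.pi + ε := by positivity
    set J := ∫ t in (-N)..N, C * Real.exp ((Real.pi + ε) * N) * ‖ψ t‖
    have hJ : 0 ≤ J := intervalIntegral.integral_nonneg hN' fun t _ => by positivity
    refine ⟨J + 1, by positivity, fun z => ?_⟩
    calc ‖G z‖ ≤ ∫ t in (-N)..N, ‖f (z + t) * ψ t‖ :=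
          intervalIntegral.norm_integral_le_integral_norm hN'
      _ ≤ ∫ t in (-N)..N, C * Real.exp ((Real.pi + ε) * N) * ‖ψ t‖ *
            Real.exp ((Real.pi + ε) * ‖z‖) := by
          refine intervalIntegral.integral_mono_on hN'
            (Continuous.intervalIntegrable (by fun_prop) _ _)
            (Continuous.intervalIntegrable (by fun_prop) _ _) fun t ht => ?_
          rw [norm_mul]
          have h1 : ‖z + t‖ ≤ N + ‖z‖ := by
            refine (norm_add_le _ _).trans ?_
            rw [Complex.norm_real, Real.norm_eq_abs, add_comm]
            gcongr
            exact abs_le.2 ht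
          calc ‖f (z + t)‖ * ‖ψ t‖ ≤ C * Real.exp ((Real.pi + ε) * (N + ‖z‖)) * ‖ψ t‖ := by
                gcongr
                exact (hfC _).trans (by gcongr)
            _ = _ := by rw [mul_add, Real.exp_add]; ring
      _ = J * Real.exp ((Real.pi + ε) * ‖z‖) := intervalIntegral.integral_mul_const _ _
      _ ≤ _ := by gcongr; linarith
  set A := ∫ x : ℝ, ‖f x‖ ^ 2
  set B := ∫ t in (-N)..N, ‖ψ t‖ ^ 2
  have hA := hd.memLp_two_iff.1 hL
  have hGM (x : ℝ) : ‖G x‖ ≤ (l * A + B / l) / 2 := by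
    -- Weighted AM-GM stands in for Cauchy–Schwarz; the weight `l` is left free for later
    -- optimisation.
    have hi (t : ℝ) : ‖f (x + t) * ψ t‖ ≤ l / 2 * ‖f (x + t)‖ ^ 2 + (2 * l)⁻¹ * ‖ψ t‖ ^ 2 := by
      rw [norm_mul]
      have h1 : l / 2 * ‖f (x + t)‖ ^ 2 + (2 * l)⁻¹ * ‖ψ t‖ ^ 2 - ‖f (x + t)‖ * ‖ψ t‖ =
        (2 * l)⁻¹ * (l * ‖f (x + t)‖ - ‖ψ t‖) ^ 2 := by field_simp; ring
      have h2 : 0 ≤ (2 * l)⁻¹ * (l * ‖f (x + t)‖ - ‖ψ t‖) ^ 2 := by positivity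
      linarith
    have hA' : ∫ t in (-N)..N, ‖f (x + t)‖ ^ 2 ≤ A := by
      rw [intervalIntegral.integral_of_le hN']
      have hsh : Integrable (fun t : ℝ => ‖f (x + t)‖ ^ 2) := by
        simpa using hA.comp_add_left x
      calc _ ≤ ∫ t : ℝ, ‖f (x + t)‖ ^ 2 :=
            setIntegral_le_integral hsh (ae_of_all _ fun t => by positivity)
        _ = A := by
            have := integral_add_left_eq_self (μ := volume) (fun t : ℝ => ‖f t‖ ^ 2) x
            simpa using this
    calc ‖G x‖ ≤ ∫ t in (-N)..N, ‖f (x + t) * ψ t‖ :=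
          intervalIntegral.norm_integral_le_integral_norm hN'
      _ ≤ ∫ t in (-N)..N, (l / 2 * ‖f (x + t)‖ ^ 2 + (2 * l)⁻¹ * ‖ψ t‖ ^ 2) :=
          intervalIntegral.integral_mono_on hN' (Continuous.intervalIntegrable (by fun_prop) _ _)
            (Continuous.intervalIntegrable (by fun_prop) _ _) fun t _ => hi t
      _ = l / 2 * (∫ t in (-N)..N, ‖f (x + t)‖ ^ 2) + (2 * l)⁻¹ * B := by
          rw [intervalIntegral.integral_add (Continuous.intervalIntegrable (by fun_prop) _ _)
            (Continuous.intervalIntegrable (by fun_prop) _ _),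
            intervalIntegral.integral_const_mul, intervalIntegral.integral_const_mul]
      _ ≤ l / 2 * A + (2 * l)⁻¹ * B := by gcongr
      _ = _ := by field_simp
  have hM0 : 0 ≤ (l * A + B / l) / 2 := (norm_nonneg _).trans (hGM 0)
  have hPL := hGτ.norm_le_of_bounded_on_real hGd hGM (lt_add_one Real.pi)
  -- Cauchy's estimate on the unit circle: there `|Im z| ≤ 1`, so leaving the real line costs the
  -- factor `exp (π + 1)`.
  have hder := Complex.norm_deriv_le_of_forall_mem_sphere_norm_le (c := 0) (R := 1)
    (C := (l * A + B / l) / 2 * Real.exp (Real.pi + 1)) one_pos hGd.diffContOnCl (fun z hz => by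
      refine (hPL z).trans ?_
      have h1 : |z.im| ≤ 1 := (Complex.abs_im_le_norm z).trans (by simpa using hz.le)
      have h2 : (Real.pi + 1) * |z.im| ≤ Real.pi + 1 :=
        mul_le_of_le_one_right (by positivity) h1
      gcongr)
  rw [(hG' 0).deriv] at hder
  simp only [zero_add, div_one] at hder
  exact hder.trans (le_of_eq (by ring))

/-- **Bernstein**: the derivative of a function in the Paley–Wiener space is square integrable on
the real line. -/
theorem memLp_deriv_of_mem_PW2 {f : ℂ → ℂ} (hf : f ∈ PW2) :
    MemLp (fun x : ℝ => deriv f x) 2 volume := by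
  have hd := hf.1
  have hfc' : Continuous (deriv f) := hd.deriv.continuous
  rw [hd.deriv.memLp_two_iff]
  set K := Real.exp (Real.pi + 1)
  have hK : 0 < K := Real.exp_pos _
  refine integrable_of_intervalIntegral_norm_bounded (ι := ℕ) (l := atTop)
    (K ^ 2 * ∫ x : ℝ, ‖f x‖ ^ 2) (a := fun n => -(n : ℝ)) (b := fun n => (n : ℝ))
    (fun n => (Continuous.integrableOn_Ioc (by fun_prop)))
    (tendsto_neg_atTop_atBot.comp tendsto_natCast_atTop_atTop) tendsto_natCast_atTop_atTop
    (Eventually.of_forall fun n => ?_)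
  -- With `ψ` the conjugate of `f'` and weight `l = K`, the bound reads `B ≤ (K² A + B) / 2`. The
  -- truncated `B` is finite and can be absorbed, leaving `B ≤ K² A` uniformly in `n`.
  have h := norm_integral_deriv_mul_le hf (ψ := fun t => star (deriv f t)) (by fun_prop)
    n.cast_nonneg hK
  set A := ∫ x : ℝ, ‖f x‖ ^ 2
  simp only [norm_star] at h
  simp only [norm_pow, norm_norm]
  have e : ∫ t in (-(n : ℝ))..n, deriv f t * star (deriv f t) =
      ((∫ t in (-(n : ℝ))..n, ‖deriv f t‖ ^ 2 : ℝ) : ℂ) := by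
    rw [← intervalIntegral.integral_ofReal]
    congr with t
    simp [Complex.mul_conj, Complex.normSq_eq_norm_sq]
  set B := ∫ t in (-(n : ℝ))..n, ‖deriv f t‖ ^ 2
  rw [e, Complex.norm_real] at h
  have h1 := (Real.le_norm_self B).trans h
  have h2 : K * (K * A + B / K) / 2 = (K ^ 2 * A + B) / 2 := by field_simp
  linarith

/-- Functions in the Paley–Wiener space are bounded on the real line. -/
theorem exists_norm_le_of_mem_PW2 {f : ℂ → ℂ} (hf : f ∈ PW2) :
    ∃ M, ∀ x : ℝ, ‖f x‖ ≤ M := by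
  have hd := hf.1
  have hfc := hd.continuous
  have hfc' : Continuous (deriv f) := hd.deriv.continuous
  -- This is the derivative of `f²`; its integrability keeps `f²`, hence `f`, bounded on the line.
  have hi : Integrable (fun x : ℝ => 2 * f x * deriv f x) := by
    simpa [mul_assoc] using (hf.2.2.integrable_mul (memLp_deriv_of_mem_PW2 hf)).const_mul 2
  set J := ∫ x : ℝ, ‖2 * f x * deriv f x‖
  have hJ : 0 ≤ J := integral_nonneg fun x => norm_nonneg _
  refine ⟨1 + (‖f 0‖ ^ 2 + J), fun x => ?_⟩
  have hF (y : ℝ) : HasDerivAt (fun y : ℝ => f y ^ 2) (2 * f y * deriv f y) y := by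
    simpa using ((hd y).hasDerivAt.comp_ofReal).fun_pow 2
  have h1 : ∫ y in (0 : ℝ)..x, 2 * f y * deriv f y = f x ^ 2 - f 0 ^ 2 := by
    simpa using intervalIntegral.integral_eq_sub_of_hasDerivAt (a := 0) (b := x) (fun y _ => hF y)
      (Continuous.intervalIntegrable (by fun_prop) _ _)
  have h2 : ‖f x ^ 2 - f 0 ^ 2‖ ≤ J := by
    rw [← h1]
    refine intervalIntegral.norm_integral_le_integral_norm_uIoc.trans ?_
    exact setIntegral_le_integral hi.norm (ae_of_all _ fun t => norm_nonneg _)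
  have h3 : ‖f x‖ ^ 2 ≤ ‖f 0‖ ^ 2 + J := by
    have := norm_sub_norm_le (f x ^ 2) (f 0 ^ 2)
    simp only [norm_pow] at this
    linarith
  nlinarith [sq_nonneg (‖f x‖ - 1), norm_nonneg (f x)]

/-! ### Contour integrals and the reproducing property of sinc -/

theorem Differentiable.dslope_zero {F : ℂ → ℂ} (hF : Differentiable ℂ F) :
    Differentiable ℂ (dslope F 0) := by
  rw [← differentiableOn_univ, Complex.differentiableOn_dslope univ_mem, differentiableOn_univ]
  exact hF

/-- Cauchy's theorem on an upper half-disc for the difference quotient of an entire function. -/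
theorem integral_dslope_eq {F : ℂ → ℂ} (hF : Differentiable ℂ F) {R : ℝ} (hR : R ≠ 0) :
    ∫ x in (-R)..R, dslope F 0 x = Complex.I * (Real.pi * F 0) -
      Complex.I * ∫ θ in (0 : ℝ)..Real.pi, F (R * Complex.exp (θ * Complex.I)) := by
  have hFc := hF.continuous
  have hR' : (R : ℂ) ≠ 0 := by exact_mod_cast hR
  have hd := hF.dslope_zero
  have hdc := hd.continuous
  -- The integrals along the diameter and along the arc are both increments of one entire primitive
  -- `P`. On the arc `dz / z = I dθ`.
  obtain ⟨P, hP⟩ := hd.isExactOn_univ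
  replace hP := fun z => hP z (mem_univ z)
  have h1 : ∫ x in (-R)..R, dslope F 0 x = P R - P (-R) := by
    rw [intervalIntegral.integral_eq_sub_of_hasDerivAt (fun y _ => (hP y).comp_ofReal)
      (Continuous.intervalIntegrable (by fun_prop) _ _)]
    simp
  have hexp (θ : ℝ) : HasDerivAt (fun θ : ℝ => (R : ℂ) * Complex.exp (θ * Complex.I))
      (R * Complex.exp (θ * Complex.I) * Complex.I) θ := by
    have h := (((hasDerivAt_id (θ : ℂ)).mul_const Complex.I).cexp.const_mul (R : ℂ)).comp_ofReal
    simpa [mul_assoc] using h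
  have h2 : ∫ θ in (0 : ℝ)..Real.pi, Complex.I * (F (R * Complex.exp (θ * Complex.I)) - F 0) =
      P (-R) - P R := by
    have h3 (θ : ℝ) : HasDerivAt (fun θ : ℝ => P (R * Complex.exp (θ * Complex.I)))
        (Complex.I * (F (R * Complex.exp (θ * Complex.I)) - F 0)) θ := by
      have h := (hP (R * Complex.exp (θ * Complex.I))).comp θ (hexp θ)
      refine h.congr_deriv ?_
      have hz : (R : ℂ) * Complex.exp (θ * Complex.I) ≠ 0 := mul_ne_zero hR' (Complex.exp_ne_zero _)
      rw [dslope_of_ne _ hz, slope_def_field]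
      field_simp
      ring
    rw [intervalIntegral.integral_eq_sub_of_hasDerivAt (fun θ _ => h3 θ)
      (Continuous.intervalIntegrable (by fun_prop) _ _)]
    simp
  rw [intervalIntegral.integral_const_mul, intervalIntegral.integral_sub
    (Continuous.intervalIntegrable (by fun_prop) _ _) intervalIntegrable_const,
    intervalIntegral.integral_const, sub_zero, Complex.real_smul] at h2
  rw [h1]
  linear_combination h2

/-- For an entire function decaying exponentially in the upper half-plane, the principal value of
`∫ (F x - F 0) / x` equals `π i F(0)`. -/
theorem tendsto_integral_dslope {F : ℂ → ℂ} (hF : Differentiable ℂ F) {M δ : ℝ} (hδ : 0 < δ)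
    (hM : ∀ z : ℂ, 0 ≤ z.im → ‖F z‖ ≤ M * Real.exp (-δ * z.im)) :
    Tendsto (fun R : ℝ => ∫ x in (-R)..R, dslope F 0 x) atTop
      (𝓝 (Complex.I * (Real.pi * F 0))) := by
  have hFc := hF.continuous
  have hM0 : 0 ≤ M := by simpa using (norm_nonneg _).trans (hM 0 le_rfl)
  have him (R θ : ℝ) : ((R : ℂ) * Complex.exp (θ * Complex.I)).im = R * Real.sin θ := by
    simp [Complex.exp_ofReal_mul_I_im]
  have h0 : Tendsto (fun R : ℝ => ∫ θ in (0 : ℝ)..Real.pi, F (R * Complex.exp (θ * Complex.I)))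
      atTop (𝓝 (∫ θ in (0 : ℝ)..Real.pi, (0 : ℂ))) := by
    refine intervalIntegral.tendsto_integral_filter_of_dominated_convergence (fun _ => M)
      (Eventually.of_forall fun R => Continuous.aestronglyMeasurable (by fun_prop)) ?_
      intervalIntegrable_const ?_
    · filter_upwards [eventually_ge_atTop 0] with R hR
      refine ae_of_all _ fun θ hθ => ?_
      rw [uIoc_of_le Real.pi_pos.le] at hθ
      have hs : 0 ≤ R * Real.sin θ := mul_nonneg hR (Real.sin_nonneg_of_nonneg_of_le_pi hθ.1.le hθ.2)
      refine (hM _ (by rwa [him])).trans ?_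
      rw [him]
      exact mul_le_of_le_one_right hM0 (Real.exp_le_one_iff.2 (by nlinarith))
    · have hpi : ∀ᵐ θ : ℝ, θ ≠ Real.pi := by simp [ae_iff, measure_singleton]
      filter_upwards [hpi] with θ hθpi hθ
      rw [uIoc_of_le Real.pi_pos.le] at hθ
      have hs : 0 < Real.sin θ :=
        Real.sin_pos_of_pos_of_lt_pi hθ.1 (lt_of_le_of_ne hθ.2 hθpi)
      refine squeeze_zero_norm' (a := fun R : ℝ => M * Real.exp (-(δ * Real.sin θ) * R)) ?_ ?_
      · filter_upwards [eventually_ge_atTop 0] with R hR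
        refine (hM _ (by rw [him]; positivity)).trans (le_of_eq ?_)
        rw [him]; ring_nf
      · have h1 : Tendsto (fun R : ℝ => -(δ * Real.sin θ) * R) atTop atBot :=
          tendsto_id.const_mul_atTop_of_neg (by have := mul_pos hδ hs; linarith)
        simpa using (Real.tendsto_exp_atBot.comp h1).const_mul M
  have h1 := (h0.const_mul Complex.I).const_sub (Complex.I * (Real.pi * F 0))
  simp only [intervalIntegral.integral_zero, mul_zero, sub_zero] at h1
  refine h1.congr' ?_
  filter_upwards [eventually_ne_atTop 0] with R hR using (integral_dslope_eq hF hR).symm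

/-- A continuous function bounded by a multiple of `1 / |x|` is square integrable. -/
theorem memLp_two_of_norm_le_of_mul_norm_le {E : Type*} [NormedAddCommGroup E]
    {f : ℝ → E} (hf : AEStronglyMeasurable f volume)
    {A B : ℝ} (hA : ∀ x, ‖f x‖ ≤ A) (hB : ∀ x, |x| * ‖f x‖ ≤ B) : MemLp f 2 volume := by
  rw [memLp_two_iff_integrable_sq_norm hf]
  refine (integrable_inv_one_add_sq.const_mul (A ^ 2 + B ^ 2)).mono' (hf.norm.pow 2)
    (ae_of_all _ fun x => ?_)
  have h1 : ‖f x‖ ^ 2 ≤ A ^ 2 := by gcongr; exact hA x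
  have h2 : (|x| * ‖f x‖) ^ 2 ≤ B ^ 2 := by gcongr; exact hB x
  rw [mul_pow, sq_abs] at h2
  rw [norm_pow, norm_norm, ← div_eq_mul_inv, le_div_iff₀ (by positivity)]
  linarith

theorem abs_mul_abs_sinc_le_one (x : ℝ) : |x| * |Real.sinc x| ≤ 1 := by
  rcases eq_or_ne x 0 with rfl | hx
  · simp
  · rw [← abs_mul, Real.sinc_of_ne_zero hx, mul_div_cancel₀ _ hx]
    exact Real.abs_sin_le_one x

theorem memLp_two_sinc_mul (s : ℝ) :
    MemLp (fun x : ℝ => (s : ℂ) * (Real.sinc (s * x) : ℂ)) 2 volume :=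
  memLp_two_of_norm_le_of_mul_norm_le (A := |s|) (B := 1)
    (Continuous.aestronglyMeasurable (by have := Real.continuous_sinc; fun_prop))
    (fun x => by
      simpa using mul_le_of_le_one_right (abs_nonneg s) (Real.abs_sinc_le_one (s * x)))
    (fun x => by
      have := abs_mul_abs_sinc_le_one (s * x)
      rw [abs_mul] at this
      simpa [mul_left_comm, mul_assoc] using this)

/-- Split `2 I sin (s x)` into exponentials. Both `f z * exp (I s z)` and `f (-z) * exp (I s z)`
decay in the upper half-plane because `s` exceeds the type, so each contributes the half-residue `π
I f 0`. Reflecting the second integral cancels the two subtracted constants `f 0`. -/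
theorem integral_mul_sinc_of_lt {f : ℂ → ℂ} (hf : f ∈ PW2) {s : ℝ} (hs : Real.pi < s) :
    ∫ x : ℝ, f x * (s * Real.sinc (s * x)) = Real.pi * f 0 := by
  have hd := hf.1
  have hs0 : s ≠ 0 := (Real.pi_pos.trans hs).ne'
  obtain ⟨M, hM⟩ := exists_norm_le_of_mem_PW2 hf
  obtain ⟨σ, hσ, hσs⟩ := exists_between hs
  have hb := hf.2.1.norm_le_of_bounded_on_real hd hM hσ
  have key (g : ℂ → ℂ) (hg : Differentiable ℂ g)
      (hgb : ∀ z, ‖g z‖ ≤ M * Real.exp (σ * |z.im|)) :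
      Tendsto (fun R : ℝ => ∫ x in (-R)..R,
        dslope (fun z => g z * Complex.exp (Complex.I * s * z)) 0 x) atTop
        (𝓝 (Complex.I * (Real.pi * g 0))) := by
    have := tendsto_integral_dslope (F := fun z => g z * Complex.exp (Complex.I * s * z))
      (hg.mul (by fun_prop)) (M := M) (δ := s - σ) (by linarith) (fun z hz => by
        rw [norm_mul, Complex.norm_exp]
        have h1 := hgb z
        rw [abs_of_nonneg hz] at h1
        have h2 : (Complex.I * s * z).re = -s * z.im := by simp
        rw [h2]
        calc _ ≤ M * Real.exp (σ * z.im) * Real.exp (-s * z.im) := by gcongr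
          _ = _ := by rw [mul_assoc, ← Real.exp_add]; ring_nf)
    simpa using this
  have h1 := key f hd hb
  have h2 := key (fun z => f (-z)) (hd.comp differentiable_neg) (fun z => by simpa using hb (-z))
  set F₁ : ℂ → ℂ := fun z => f z * Complex.exp (Complex.I * s * z) with hF₁
  set F₂ : ℂ → ℂ := fun z => f (-z) * Complex.exp (Complex.I * s * z) with hF₂
  have hc1 : Continuous (dslope F₁ 0) :=
    (hd.mul (by fun_prop : Differentiable ℂ fun z : ℂ => Complex.exp (Complex.I * s * z))).dslope_zero.continuous
  have hc2 : Continuous (dslope F₂ 0) :=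
    ((hd.comp differentiable_neg).mul
      (by fun_prop : Differentiable ℂ fun z : ℂ => Complex.exp (Complex.I * s * z))).dslope_zero.continuous
  have h3 := h1.add h2
  have hne : ∀ᵐ x : ℝ, x ≠ 0 := by simp [ae_iff, measure_singleton]
  have e (R : ℝ) : (∫ x in (-R)..R, dslope F₁ 0 x) + (∫ x in (-R)..R, dslope F₂ 0 x) =
      ∫ x in (-R)..R, 2 * Complex.I * (f x * (s * Real.sinc (s * x))) := by
    have e1 : ∫ x in (-R)..R, dslope F₂ 0 x = ∫ x in (-R)..R, dslope F₂ 0 (-x : ℂ) := by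
      have := intervalIntegral.integral_comp_neg (a := -R) (b := R)
        (fun x : ℝ => dslope F₂ 0 (x : ℂ))
      simpa using this.symm
    rw [e1, ← intervalIntegral.integral_add (Continuous.intervalIntegrable (by fun_prop) _ _)
      (Continuous.intervalIntegrable (by fun_prop) _ _)]
    refine intervalIntegral.integral_congr_ae ?_
    filter_upwards [hne] with x hx _
    have hxc : (x : ℂ) ≠ 0 := by exact_mod_cast hx
    have hsc : (s : ℂ) ≠ 0 := by exact_mod_cast hs0
    rw [dslope_of_ne _ hxc, dslope_of_ne _ (neg_ne_zero.2 hxc), slope_def_field, slope_def_field,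
      Real.sinc_of_ne_zero (mul_ne_zero hs0 hx)]
    push_cast
    rw [Complex.sin]
    simp only [hF₁, hF₂, neg_neg, mul_zero, Complex.exp_zero, mul_one, neg_zero, sub_zero]
    have e2 : Complex.I * s * -x = -(s * x) * Complex.I := by ring
    have e3 : Complex.I * s * x = (s * x) * Complex.I := by ring
    rw [e2, e3]
    field_simp
    linear_combination -(Complex.exp (-(s * x * Complex.I)) - Complex.exp (s * x * Complex.I)) * f x * Complex.I_sq
  simp only [e, neg_zero] at h3
  have hi : Integrable (fun x : ℝ => f x * (s * Real.sinc (s * x))) :=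
    hf.2.2.integrable_mul (memLp_two_sinc_mul s)
  have h4 := intervalIntegral_tendsto_integral (hi.const_mul (2 * Complex.I))
    tendsto_neg_atTop_atBot tendsto_id
  have h5 := tendsto_nhds_unique h4 h3
  rw [integral_const_mul] at h5
  have hI : (2 * Complex.I) ≠ 0 := by simp
  apply mul_left_cancel₀ hI
  rw [h5]; ring

/-- The cardinal sine reproduces the value at the origin on the Paley–Wiener space. -/
theorem integral_mul_sinc {f : ℂ → ℂ} (hf : f ∈ PW2) :
    ∫ x : ℝ, f x * Real.sinc (Real.pi * x) = f 0 := by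
  have hpi : (Real.pi : ℂ) ≠ 0 := by exact_mod_cast Real.pi_ne_zero
  have hsc := Real.continuous_sinc
  have hfc := hf.1.continuous
  -- Dominating function for the limit `s ↓ π`. For `s < 4`, `(s sinc (s x))² ≤ 16` and `x² (s sinc
  -- (s x))² ≤ 1`; adding gives `17 = 4² + 1²`.
  have hB : MemLp (fun x : ℝ => Real.sqrt (17 * (1 + x ^ 2)⁻¹)) 2 volume := by
    rw [memLp_two_iff_integrable_sq]
    · refine (integrable_inv_one_add_sq.const_mul 17).congr (ae_of_all _ fun x => ?_)
      exact (Real.sq_sqrt (by positivity)).symm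
    · exact (by fun_prop : Measurable fun x : ℝ =>
        Real.sqrt (17 * (1 + x ^ 2)⁻¹)).aestronglyMeasurable
  have h1 : Tendsto (fun s : ℝ => ∫ x : ℝ, f x * (s * Real.sinc (s * x))) (𝓝[>] Real.pi)
      (𝓝 (∫ x : ℝ, f x * (Real.pi * Real.sinc (Real.pi * x)))) := by
    refine tendsto_integral_filter_of_dominated_convergence
      (fun x => ‖f x‖ * Real.sqrt (17 * (1 + x ^ 2)⁻¹))
      (Eventually.of_forall fun s => Continuous.aestronglyMeasurable (by fun_prop)) ?_
      (hf.2.2.norm.integrable_mul hB) (ae_of_all _ fun x => ?_)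
    · filter_upwards [Ioo_mem_nhdsGT Real.pi_lt_four] with s hs
      have hs0 : 0 < s := Real.pi_pos.trans hs.1
      refine ae_of_all _ fun x => ?_
      rw [norm_mul]
      gcongr
      refine Real.le_sqrt_of_sq_le ?_
      have a1 := abs_mul_abs_sinc_le_one (s * x)
      have a2 := Real.abs_sinc_le_one (s * x)
      rw [abs_mul, abs_of_pos hs0] at a1
      have a3 : s * |Real.sinc (s * x)| ≤ 4 := by nlinarith [hs.2, abs_nonneg (Real.sinc (s * x))]
      simp only [norm_mul, Complex.norm_real, Real.norm_eq_abs, abs_of_pos hs0]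
      have a4 : (s * |Real.sinc (s * x)|) ^ 2 ≤ 4 ^ 2 := by gcongr
      have a5 : (s * |x| * |Real.sinc (s * x)|) ^ 2 ≤ 1 ^ 2 := by gcongr
      have a6 : (s * |x| * |Real.sinc (s * x)|) ^ 2 = x ^ 2 * (s * |Real.sinc (s * x)|) ^ 2 := by
        rw [← sq_abs x]; ring
      rw [← div_eq_mul_inv, le_div_iff₀ (by positivity)]
      linarith
    · refine Tendsto.mono_left ?_ nhdsWithin_le_nhds
      exact Continuous.tendsto (f := fun s : ℝ => f x * (s * Real.sinc (s * x) : ℂ))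
        (by fun_prop) _
  have h2 : Tendsto (fun s : ℝ => ∫ x : ℝ, f x * (s * Real.sinc (s * x))) (𝓝[>] Real.pi)
      (𝓝 (Real.pi * f 0)) := by
    refine tendsto_const_nhds.congr' ?_
    filter_upwards [self_mem_nhdsWithin] with s hs using (integral_mul_sinc_of_lt hf hs).symm
  have h3 := tendsto_nhds_unique h1 h2
  simp only [mul_left_comm _ (Real.pi : ℂ), integral_const_mul] at h3
  exact mul_left_cancel₀ hpi h3

/-! ### The evaluation kernel and its reproducing property -/

/-- The kernel representing evaluation at `0` for the norm `∫ (‖g‖ ^ 2 + a * ‖g'‖ ^ 2)`. -/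
noncomputable def evalKernel (a : ℝ) (z : ℂ) : ℂ :=
  ∫ t in (0 : ℝ)..1, Complex.cos ((Real.pi : ℂ) * z * (t : ℂ)) /
    (1 + (a : ℂ) * (Real.pi : ℂ) ^ 2 * (t : ℂ) ^ 2)

/-- The derivative of `evalKernel`. -/
noncomputable def evalKernelDeriv (a : ℝ) (z : ℂ) : ℂ :=
  ∫ t in (0 : ℝ)..1, -(Real.pi * t * Complex.sin ((Real.pi : ℂ) * z * (t : ℂ))) /
    (1 + (a : ℂ) * (Real.pi : ℂ) ^ 2 * (t : ℂ) ^ 2)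

/-- The second derivative of `evalKernel`. -/
noncomputable def evalKernelDeriv₂ (a : ℝ) (z : ℂ) : ℂ :=
  ∫ t in (0 : ℝ)..1, -((Real.pi * t) ^ 2 * Complex.cos ((Real.pi : ℂ) * z * (t : ℂ))) /
    (1 + (a : ℂ) * (Real.pi : ℂ) ^ 2 * (t : ℂ) ^ 2)

theorem extremalFun_eq (a : ℝ) : extremalFun a = fun z => (sharpConst a : ℂ) * evalKernel a z := rfl

theorem one_add_weight_ne_zero {a : ℝ} (ha : 0 < a) (t : ℝ) :
    (1 + (a : ℂ) * (Real.pi : ℂ) ^ 2 * (t : ℂ) ^ 2) ≠ 0 := by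
  have : 0 < 1 + a * Real.pi ^ 2 * t ^ 2 := by positivity
  exact_mod_cast this.ne'

theorem hasDerivAt_evalKernel {a : ℝ} (ha : 0 < a) (z : ℂ) : HasDerivAt (evalKernel a) (evalKernelDeriv a z) z := by
  have h0 := one_add_weight_ne_zero ha
  refine hasDerivAt_intervalIntegral_of_continuous
    (Φ := fun z t => Complex.cos ((Real.pi : ℂ) * z * (t : ℂ)) /
      (1 + (a : ℂ) * (Real.pi : ℂ) ^ 2 * (t : ℂ) ^ 2))
    (Φ' := fun z t => -(Real.pi * t * Complex.sin ((Real.pi : ℂ) * z * (t : ℂ))) /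
      (1 + (a : ℂ) * (Real.pi : ℂ) ^ 2 * (t : ℂ) ^ 2)) 0 1
    (fun z => Continuous.div (by fun_prop) (by fun_prop) h0)
    (Continuous.div (by fun_prop) (by fun_prop) fun p => h0 p.2) (fun z t => ?_) z
  have h := (((hasDerivAt_id z).const_mul (Real.pi : ℂ)).mul_const (t : ℂ)).ccos.div_const
    (1 + (a : ℂ) * (Real.pi : ℂ) ^ 2 * (t : ℂ) ^ 2)
  refine h.congr_deriv ?_
  simp only [id]
  ring

theorem hasDerivAt_evalKernelDeriv {a : ℝ} (ha : 0 < a) (z : ℂ) :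
    HasDerivAt (evalKernelDeriv a) (evalKernelDeriv₂ a z) z := by
  have h0 := one_add_weight_ne_zero ha
  refine hasDerivAt_intervalIntegral_of_continuous
    (Φ := fun z t => -(Real.pi * t * Complex.sin ((Real.pi : ℂ) * z * (t : ℂ))) /
      (1 + (a : ℂ) * (Real.pi : ℂ) ^ 2 * (t : ℂ) ^ 2))
    (Φ' := fun z t => -((Real.pi * t) ^ 2 * Complex.cos ((Real.pi : ℂ) * z * (t : ℂ))) /
      (1 + (a : ℂ) * (Real.pi : ℂ) ^ 2 * (t : ℂ) ^ 2)) 0 1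
    (fun z => Continuous.div (by fun_prop) (by fun_prop) h0)
    (Continuous.div (by fun_prop) (by fun_prop) fun p => h0 p.2) (fun z t => ?_) z
  have h := ((((hasDerivAt_id z).const_mul (Real.pi : ℂ)).mul_const (t : ℂ)).csin.const_mul
    (Real.pi * t : ℂ)).neg.div_const (1 + (a : ℂ) * (Real.pi : ℂ) ^ 2 * (t : ℂ) ^ 2)
  refine h.congr_deriv ?_
  simp only [id]
  ring

theorem differentiable_evalKernel {a : ℝ} (ha : 0 < a) : Differentiable ℂ (evalKernel a) :=
  fun z => (hasDerivAt_evalKernel ha z).differentiableAt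

theorem deriv_evalKernel {a : ℝ} (ha : 0 < a) : deriv (evalKernel a) = evalKernelDeriv a :=
  funext fun z => (hasDerivAt_evalKernel ha z).deriv

theorem one_le_norm_weight {a : ℝ} (ha : 0 < a) (t : ℝ) :
    1 ≤ ‖(1 + (a : ℂ) * (Real.pi : ℂ) ^ 2 * (t : ℂ) ^ 2)‖ := by
  have h : (1 + (a : ℂ) * (Real.pi : ℂ) ^ 2 * (t : ℂ) ^ 2) =
    ((1 + a * Real.pi ^ 2 * t ^ 2 : ℝ) : ℂ) := by push_cast; ring
  have h2 : 0 ≤ a * Real.pi ^ 2 * t ^ 2 := by positivity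
  rw [h, Complex.norm_real, Real.norm_of_nonneg (by positivity)]
  linarith

theorem expTypeAtMost_evalKernel {a : ℝ} (ha : 0 < a) : ExpTypeAtMost Real.pi (evalKernel a) := fun ε hε => by
  refine ⟨1, one_pos, fun z => ?_⟩
  have h : ∀ t ∈ uIoc (0 : ℝ) 1, ‖Complex.cos ((Real.pi : ℂ) * z * (t : ℂ)) /
      (1 + (a : ℂ) * (Real.pi : ℂ) ^ 2 * (t : ℂ) ^ 2)‖ ≤ Real.exp ((Real.pi + ε) * ‖z‖) := by
    intro t ht
    rw [uIoc_of_le zero_le_one] at ht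
    rw [norm_div]
    refine (div_le_self (norm_nonneg _) (one_le_norm_weight ha t)).trans ?_
    have hcos (w : ℂ) : ‖Complex.cos w‖ ≤ Real.exp ‖w‖ := by
      rw [Complex.cos, norm_div, Complex.norm_ofNat, div_le_iff₀ two_pos, mul_two]
      refine (norm_add_le _ _).trans (add_le_add ?_ ?_) <;>
      · refine (Complex.norm_exp_le_exp_norm _).trans ?_
        simp
    refine (hcos _).trans (Real.exp_le_exp.2 ?_)
    simp only [norm_mul, Complex.norm_real, Real.norm_of_nonneg Real.pi_pos.le,
      Real.norm_of_nonneg ht.1.le]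
    calc Real.pi * ‖z‖ * t ≤ Real.pi * ‖z‖ * 1 := by gcongr; exact ht.2
      _ ≤ _ := by rw [mul_one]; gcongr; linarith
  have := intervalIntegral.norm_integral_le_of_norm_le_const h
  simpa [evalKernel] using this

/-- Realness on the line lets the bilinear pairing, without conjugates, serve as the inner product
with the kernel. -/
theorem evalKernel_ofReal (a x : ℝ) : evalKernel a x =
    ((∫ t in (0 : ℝ)..1, Real.cos (Real.pi * x * t) / (1 + a * Real.pi ^ 2 * t ^ 2) : ℝ) : ℂ) := by
  rw [evalKernel, ← intervalIntegral.integral_ofReal]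
  push_cast
  rfl

theorem evalKernelDeriv_ofReal (a x : ℝ) : evalKernelDeriv a x =
    ((∫ t in (0 : ℝ)..1, -(Real.pi * t * Real.sin (Real.pi * x * t)) /
      (1 + a * Real.pi ^ 2 * t ^ 2) : ℝ) : ℂ) := by
  rw [evalKernelDeriv, ← intervalIntegral.integral_ofReal]
  push_cast
  rfl

/-- One integration by parts in `t` gains the factor `1 / (π x)`: the boundary term is at most 1,
and the derivative of the inverse weight at most `2 a π²` on `[0, 1]`. This decay places the kernel
in `L²`. -/
theorem abs_mul_norm_evalKernel_le {a : ℝ} (ha : 0 < a) (x : ℝ) :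
    |x| * ‖evalKernel a x‖ ≤ (1 + 2 * a * Real.pi ^ 2) / Real.pi := by
  have hpi := Real.pi_pos
  set w : ℝ → ℝ := fun t => 1 + a * Real.pi ^ 2 * t ^ 2 with hw
  have hw1 (t : ℝ) : 1 ≤ w t := by
    have : 0 ≤ a * Real.pi ^ 2 * t ^ 2 := by positivity
    simp only [hw]; linarith
  have hw0 (t : ℝ) : w t ≠ 0 := (zero_lt_one.trans_le (hw1 t)).ne'
  have hwd (t : ℝ) : HasDerivAt (fun t => (w t)⁻¹) (-(2 * a * Real.pi ^ 2 * t) / w t ^ 2) t := by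
    have h := (((hasDerivAt_id t).fun_pow 2).const_mul (a * Real.pi ^ 2)).const_add 1
    refine (h.fun_inv (hw0 t)).congr_deriv ?_
    simp only [id, hw]
    ring
  have hsd (t : ℝ) : HasDerivAt (fun t => Real.sin (Real.pi * x * t))
      (Real.pi * x * Real.cos (Real.pi * x * t)) t := by
    have h := ((hasDerivAt_id t).const_mul (Real.pi * x)).sin
    refine h.congr_deriv ?_
    simp only [id]; ring
  have hwc : Continuous w := by fun_prop
  have ibp := intervalIntegral.integral_mul_deriv_eq_deriv_mul (a := 0) (b := 1)
    (fun t _ => hwd t) (fun t _ => hsd t)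
    (Continuous.intervalIntegrable
      (Continuous.div (by fun_prop) (by fun_prop) fun t => pow_ne_zero 2 (hw0 t)) _ _)
    (Continuous.intervalIntegrable (by fun_prop) _ _)
  have e : Real.pi * x * (∫ t in (0 : ℝ)..1, Real.cos (Real.pi * x * t) / w t) =
      ∫ t in (0 : ℝ)..1, (w t)⁻¹ * (Real.pi * x * Real.cos (Real.pi * x * t)) := by
    rw [← intervalIntegral.integral_const_mul]
    congr with t
    ring
  have hI : ‖∫ t in (0 : ℝ)..1, -(2 * a * Real.pi ^ 2 * t) / w t ^ 2 * Real.sin (Real.pi * x * t)‖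
      ≤ 2 * a * Real.pi ^ 2 * |1 - 0| := by
    refine intervalIntegral.norm_integral_le_of_norm_le_const fun t ht => ?_
    rw [uIoc_of_le zero_le_one] at ht
    rw [norm_mul, norm_div, norm_neg, Real.norm_of_nonneg (by have := ht.1; positivity),
      Real.norm_of_nonneg (by positivity)]
    have h1 : 2 * a * Real.pi ^ 2 * t / w t ^ 2 ≤ 2 * a * Real.pi ^ 2 := by
      refine (div_le_self (by have := ht.1; positivity) (one_le_pow₀ (hw1 t))).trans ?_
      exact mul_le_of_le_one_right (by positivity) ht.2
    have h2 : ‖Real.sin (Real.pi * x * t)‖ ≤ 1 := Real.abs_sin_le_one _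
    calc _ ≤ 2 * a * Real.pi ^ 2 * 1 := by gcongr
      _ = _ := mul_one _
  rw [evalKernel_ofReal, Complex.norm_real, le_div_iff₀ hpi]
  have h3 : |x| * ‖∫ t in (0 : ℝ)..1, Real.cos (Real.pi * x * t) / w t‖ * Real.pi =
      ‖Real.pi * x * ∫ t in (0 : ℝ)..1, Real.cos (Real.pi * x * t) / w t‖ := by
    rw [norm_mul, norm_mul, Real.norm_of_nonneg hpi.le, Real.norm_eq_abs x]; ring
  rw [h3, e, ibp]
  have h4 : ‖(w 1)⁻¹ * Real.sin (Real.pi * x * 1) - (w 0)⁻¹ * Real.sin (Real.pi * x * 0)‖ ≤ 1 := by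
    rw [mul_zero, Real.sin_zero, mul_zero, sub_zero, norm_mul]
    have h5 : ‖(w 1)⁻¹‖ ≤ 1 := by
      rw [norm_inv]
      exact inv_le_one_of_one_le₀ ((hw1 1).trans (Real.le_norm_self _))
    exact mul_le_one₀ h5 (norm_nonneg _) (Real.abs_sin_le_one _)
  refine (norm_sub_le _ _).trans ?_
  simp only [sub_zero, abs_one, mul_one] at hI
  exact add_le_add h4 hI

theorem evalKernel_mem_PW2 {a : ℝ} (ha : 0 < a) : evalKernel a ∈ PW2 := by
  refine ⟨differentiable_evalKernel ha, expTypeAtMost_evalKernel ha,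
    memLp_two_of_norm_le_of_mul_norm_le (A := 1) ?_ (fun x => ?_)
      (abs_mul_norm_evalKernel_le ha)⟩
  · exact ((differentiable_evalKernel ha).continuous.comp
      Complex.continuous_ofReal).aestronglyMeasurable
  · have h : ∀ t ∈ uIoc (0 : ℝ) 1, ‖Complex.cos ((Real.pi : ℂ) * x * (t : ℂ)) /
        (1 + (a : ℂ) * (Real.pi : ℂ) ^ 2 * (t : ℂ) ^ 2)‖ ≤ 1 := by
      intro t _
      rw [norm_div]
      refine (div_le_self (norm_nonneg _) (one_le_norm_weight ha t)).trans ?_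
      rw [← Complex.ofReal_mul, ← Complex.ofReal_mul, ← Complex.ofReal_cos, Complex.norm_real]
      exact Real.abs_cos_le_one _
    simpa [evalKernel] using intervalIntegral.norm_integral_le_of_norm_le_const h

/-- The kernel solves `K - a K'' = sinc (π x)`. -/
theorem evalKernel_sub_mul_evalKernelDeriv₂ {a : ℝ} (ha : 0 < a) (x : ℝ) :
    evalKernel a x - a * evalKernelDeriv₂ a x = Real.sinc (Real.pi * x) := by
  have h0 := one_add_weight_ne_zero ha
  have e : evalKernel a x - a * evalKernelDeriv₂ a x =
      ((∫ t in (0 : ℝ)..1, Real.cos (Real.pi * x * t) : ℝ) : ℂ) := by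
    have c1 : Continuous fun t : ℝ => Complex.cos ((Real.pi : ℂ) * x * (t : ℂ)) /
        (1 + (a : ℂ) * (Real.pi : ℂ) ^ 2 * (t : ℂ) ^ 2) :=
      Continuous.div (by fun_prop) (by fun_prop) h0
    have c2 : Continuous fun t : ℝ =>
        (a : ℂ) * (-((Real.pi * t : ℂ) ^ 2 * Complex.cos ((Real.pi : ℂ) * x * (t : ℂ))) /
          (1 + (a : ℂ) * (Real.pi : ℂ) ^ 2 * (t : ℂ) ^ 2)) :=
      continuous_const.mul (Continuous.div (by fun_prop) (by fun_prop) h0)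
    rw [evalKernel, evalKernelDeriv₂, ← intervalIntegral.integral_const_mul,
      ← intervalIntegral.integral_sub (c1.intervalIntegrable _ _) (c2.intervalIntegrable _ _),
      ← intervalIntegral.integral_ofReal]
    congr with t
    have := h0 t
    push_cast
    rw [← mul_div_assoc, ← sub_div, div_eq_iff this]
    ring
  rw [e]
  congr 1
  rcases eq_or_ne x 0 with rfl | hx
  · simp
  · have hpx : Real.pi * x ≠ 0 := mul_ne_zero Real.pi_ne_zero hx
    rw [Real.sinc_of_ne_zero hpx, intervalIntegral.integral_comp_mul_left _ hpx]
    simp [div_eq_inv_mul]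

/-- The differential equation expresses `a K''` as `K` minus a sinc, both square integrable. -/
theorem memLp_evalKernelDeriv₂ {a : ℝ} (ha : 0 < a) : MemLp (fun x : ℝ => evalKernelDeriv₂ a x) 2 volume := by
  have hac : (a : ℂ) ≠ 0 := by exact_mod_cast ha.ne'
  have hpi : (Real.pi : ℂ) ≠ 0 := by exact_mod_cast Real.pi_ne_zero
  have h := ((evalKernel_mem_PW2 ha).2.2.sub
    ((memLp_two_sinc_mul Real.pi).const_mul (Real.pi : ℂ)⁻¹)).const_mul (a : ℂ)⁻¹
  refine h.ae_eq (ae_of_all _ fun x => ?_)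
  simp only [Pi.sub_apply]
  rw [inv_mul_cancel_left₀ hpi, ← evalKernel_sub_mul_evalKernelDeriv₂ ha x]
  field_simp
  ring

theorem integrable_mul_evalKernel {a : ℝ} (ha : 0 < a) {f : ℂ → ℂ} (hf : f ∈ PW2) :
    Integrable fun x : ℝ => f x * evalKernel a x + a * (deriv f x * evalKernelDeriv a x) := by
  have hK' := memLp_deriv_of_mem_PW2 (evalKernel_mem_PW2 ha)
  rw [deriv_evalKernel ha] at hK'
  exact (hf.2.2.integrable_mul (evalKernel_mem_PW2 ha).2.2).add
    (((memLp_deriv_of_mem_PW2 hf).integrable_mul hK').const_mul _)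

/-- `evalKernel` reproduces the value at the origin. -/
theorem integral_mul_evalKernel {a : ℝ} (ha : 0 < a) {f : ℂ → ℂ} (hf : f ∈ PW2) :
    ∫ x : ℝ, (f x * evalKernel a x + a * (deriv f x * evalKernelDeriv a x)) = f 0 := by
  have hK := (evalKernel_mem_PW2 ha).2.2
  have hK' := memLp_deriv_of_mem_PW2 (evalKernel_mem_PW2 ha)
  rw [deriv_evalKernel ha] at hK'
  have hK₂ := memLp_evalKernelDeriv₂ ha
  have hf' := memLp_deriv_of_mem_PW2 hf
  have i1 : Integrable fun x : ℝ => f x * evalKernel a x := hf.2.2.integrable_mul hK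
  have i2 : Integrable fun x : ℝ => deriv f x * evalKernelDeriv a x := hf'.integrable_mul hK'
  have i3 : Integrable fun x : ℝ => f x * evalKernelDeriv₂ a x := hf.2.2.integrable_mul hK₂
  -- Integrability of `f K''`, `f' K'` and `f K'` makes the boundary terms at infinity vanish.
  have ibp := integral_mul_deriv_eq_deriv_mul_of_integrable
    (fun x _ => (hf.1 (x : ℂ)).hasDerivAt.comp_ofReal)
    (fun x _ => (hasDerivAt_evalKernelDeriv ha (x : ℂ)).comp_ofReal)
    i3 i2 (hf.2.2.integrable_mul hK')
  rw [← integral_mul_sinc hf, integral_add i1 (i2.const_mul _), integral_const_mul,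
    ← neg_eq_iff_eq_neg.2 ibp, mul_neg, ← sub_eq_add_neg, ← integral_const_mul,
    ← integral_sub i1 (i3.const_mul _)]
  refine integral_congr_ae (ae_of_all _ fun x => ?_)
  simp only
  rw [← evalKernel_sub_mul_evalKernelDeriv₂ ha x]
  ring

/-! ### The extremal function and the Pythagorean identity -/

theorem sharpConst_pos {a : ℝ} (ha : 0 < a) : 0 < sharpConst a := by
  have h : 0 < Real.pi * Real.sqrt a := by positivity
  exact div_pos h (Real.arctan_pos.2 h)

theorem evalKernel_zero {a : ℝ} (ha : 0 < a) : evalKernel a 0 = ((sharpConst a)⁻¹ : ℝ) := by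
  have h : 0 < Real.pi * Real.sqrt a := by positivity
  have e := evalKernel_ofReal a 0
  rw [Complex.ofReal_zero] at e
  rw [e]
  congr 1
  have h1 : ∫ t in (0 : ℝ)..1, Real.cos (Real.pi * 0 * t) / (1 + a * Real.pi ^ 2 * t ^ 2) =
      ∫ t in (0 : ℝ)..1, 1 / (1 + (Real.pi * Real.sqrt a * t) ^ 2) := by
    congr with t
    rw [mul_pow, mul_pow, Real.sq_sqrt ha.le]
    simp [mul_comm]
  rw [h1, intervalIntegral.integral_comp_mul_left (fun u => 1 / (1 + u ^ 2)) h.ne',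
    integral_one_div_one_add_sq]
  simp [sharpConst, div_eq_inv_mul]

theorem extremalFun_mem_PW2 {a : ℝ} (ha : 0 < a) : extremalFun a ∈ PW2 := by
  rw [extremalFun_eq]
  obtain ⟨h1, h2, h3⟩ := evalKernel_mem_PW2 ha
  have hC := sharpConst_pos ha
  refine ⟨h1.const_mul _, fun ε hε => ?_, h3.const_mul _⟩
  obtain ⟨C, hC0, hb⟩ := h2 ε hε
  refine ⟨sharpConst a * C, by positivity, fun z => ?_⟩
  rw [norm_mul, Complex.norm_real, Real.norm_of_nonneg hC.le, mul_assoc]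
  gcongr
  exact hb z

theorem extremalFun_zero {a : ℝ} (ha : 0 < a) : extremalFun a 0 = 1 := by
  rw [extremalFun_eq]
  simp only
  rw [evalKernel_zero ha, ← Complex.ofReal_mul, mul_inv_cancel₀ (sharpConst_pos ha).ne',
    Complex.ofReal_one]

theorem integrable_energy {g : ℂ → ℂ} (hg : g ∈ PW2) (a : ℝ) :
    Integrable fun x : ℝ => ‖g x‖ ^ 2 + a * ‖deriv g x‖ ^ 2 :=
  (hg.1.memLp_two_iff.1 hg.2.2).add
    ((hg.1.deriv.memLp_two_iff.1 (memLp_deriv_of_mem_PW2 hg)).const_mul a)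

/-- The Pythagorean identity for the distance to the extremal function. -/
theorem integral_energy_sub_extremalFun {a : ℝ} (ha : 0 < a) {g : ℂ → ℂ} (hg : g ∈ PW2)
    (h0 : g 0 = 1) :
    Integrable (fun x : ℝ => ‖g x - extremalFun a x‖ ^ 2 +
      a * ‖deriv g x - deriv (extremalFun a) x‖ ^ 2) ∧
    ∫ x : ℝ, (‖g x - extremalFun a x‖ ^ 2 + a * ‖deriv g x - deriv (extremalFun a) x‖ ^ 2) =
      (∫ x : ℝ, (‖g x‖ ^ 2 + a * ‖deriv g x‖ ^ 2)) - sharpConst a := by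
  have hC := sharpConst_pos ha
  set C := sharpConst a
  have hK := evalKernel_mem_PW2 ha
  have hd (z : ℂ) : deriv (extremalFun a) z = C * evalKernelDeriv a z :=
    ((hasDerivAt_evalKernel ha z).const_mul _).deriv
  have sq (u v : ℂ) (hv : v.im = 0) :
      ‖u - C * v‖ ^ 2 = ‖u‖ ^ 2 + C ^ 2 * (v * v).re - 2 * C * (u * v).re := by
    simp only [← Complex.normSq_eq_norm_sq, Complex.normSq_apply, Complex.sub_re, Complex.sub_im,
      Complex.mul_re, Complex.mul_im, Complex.ofReal_re, Complex.ofReal_im, hv]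
    ring
  have e : (fun x : ℝ => ‖g x - extremalFun a x‖ ^ 2 +
      a * ‖deriv g x - deriv (extremalFun a) x‖ ^ 2) = fun x : ℝ =>
      (‖g x‖ ^ 2 + a * ‖deriv g x‖ ^ 2) +
      C ^ 2 * (evalKernel a x * evalKernel a x +
        a * (deriv (evalKernel a) x * evalKernelDeriv a x)).re -
      2 * C * (g x * evalKernel a x + a * (deriv g x * evalKernelDeriv a x)).re := by
    funext x
    rw [hd, extremalFun_eq, sq _ _ (by rw [evalKernel_ofReal, Complex.ofReal_im]),
      sq _ _ (by rw [evalKernelDeriv_ofReal, Complex.ofReal_im]), deriv_evalKernel ha]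
    simp only [Complex.add_re, Complex.re_ofReal_mul]
    ring
  have i1 := integrable_energy hg a
  have i2 := integrable_mul_evalKernel ha hK
  have i3 := integrable_mul_evalKernel ha hg
  have r2 := integral_re i2
  have r3 := integral_re i3
  -- Reproduction applied to the kernel itself gives its energy `K 0 = 1 / C`; applied to `g` it
  -- gives `g 0 = 1`. The correction is then `C² / C - 2 C = -C`.
  rw [integral_mul_evalKernel ha hK, evalKernel_zero ha] at r2
  rw [integral_mul_evalKernel ha hg, h0] at r3
  simp only [RCLike.re_eq_complex_re, Complex.ofReal_re, Complex.one_re] at r2 r3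
  have j2 := i2.re.const_mul (C ^ 2)
  have j3 := i3.re.const_mul (2 * C)
  simp only [RCLike.re_eq_complex_re] at j2 j3
  rw [e]
  have j12 : Integrable fun x : ℝ => (‖g x‖ ^ 2 + a * ‖deriv g x‖ ^ 2) +
      C ^ 2 * (evalKernel a x * evalKernel a x +
        a * (deriv (evalKernel a) x * evalKernelDeriv a x)).re := i1.add j2
  refine ⟨j12.sub j3, ?_⟩
  rw [integral_sub j12 j3, integral_add i1 j2, integral_const_mul, integral_const_mul,
    r2, r3]
  change _ + C ^ 2 * C⁻¹ - _ = _
  field_simp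
  ring

theorem mainTheorem5 (a : ℝ) (ha : 0 < a) :
    (∀ g : ℂ → ℂ, g ∈ PW2 → g 0 = 1 →
      Integrable (fun x : ℝ => ‖g (x : ℂ)‖ ^ 2 + a * ‖deriv g (x : ℂ)‖ ^ 2) volume ∧
      sharpConst a ≤ ∫ x : ℝ, (‖g (x : ℂ)‖ ^ 2 + a * ‖deriv g (x : ℂ)‖ ^ 2)) ∧
    extremalFun a ∈ PW2 ∧ extremalFun a 0 = 1 ∧
    (∀ g : ℂ → ℂ, g ∈ PW2 → g 0 = 1 →
      (∫ x : ℝ, (‖g (x : ℂ)‖ ^ 2 + a * ‖deriv g (x : ℂ)‖ ^ 2) = sharpConst a ↔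
        g = extremalFun a)) := by
  have hE := extremalFun_mem_PW2 ha
  refine ⟨fun g hg h0 => ⟨integrable_energy hg a, ?_⟩, hE, extremalFun_zero ha,
    fun g hg h0 => ?_⟩
  · have h := (integral_energy_sub_extremalFun ha hg h0).2
    have h1 : 0 ≤ ∫ x : ℝ, (‖g x - extremalFun a x‖ ^ 2 +
        a * ‖deriv g x - deriv (extremalFun a) x‖ ^ 2) :=
      integral_nonneg fun x => by positivity
    linarith
  obtain ⟨hi, h⟩ := integral_energy_sub_extremalFun ha hg h0
  have hgc := hg.1.continuous
  have hgc' : Continuous (deriv g) := hg.1.deriv.continuous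
  have hEc := hE.1.continuous
  have hEc' : Continuous (deriv (extremalFun a)) := hE.1.deriv.continuous
  constructor
  · intro heq
    rw [heq, sub_self, integral_eq_zero_iff_of_nonneg (fun x => by positivity) hi] at h
    -- Continuity upgrades almost everywhere vanishing to every real point; the identity theorem
    -- then extends equality to the plane.
    have h2 := (Continuous.ae_eq_iff_eq volume (by fun_prop) continuous_zero).1 h
    have h3 (x : ℝ) : g x = extremalFun a x := by
      have h4 := congrFun h2 x
      simp only [Pi.zero_apply] at h4
      have h5 : 0 ≤ a * ‖deriv g x - deriv (extremalFun a) x‖ ^ 2 := by positivity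
      have h6 : ‖g x - extremalFun a x‖ ^ 2 = 0 :=
        le_antisymm (by linarith) (by positivity)
      exact sub_eq_zero.1 (norm_eq_zero.1 (pow_eq_zero_iff two_ne_zero |>.1 h6))
    refine AnalyticOnNhd.eq_of_frequently_eq (z₀ := 0) (fun z _ => hg.1.analyticAt z)
      (fun z _ => hE.1.analyticAt z) ?_
    have ht : Tendsto (fun x : ℝ => (x : ℂ)) (𝓝[≠] 0) (𝓝[≠] 0) := by
      refine tendsto_nhdsWithin_iff.2 ⟨?_, ?_⟩
      · exact (Complex.continuous_ofReal.tendsto' 0 0 (by simp)).mono_left nhdsWithin_le_nhds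
      · filter_upwards [self_mem_nhdsWithin] with x hx
        simpa using hx
    exact ht.frequently (Frequently.of_forall h3)
  · rintro rfl
    simp only [sub_self, norm_zero, ne_eq, OfNat.ofNat_ne_zero, not_false_eq_true, zero_pow,
      mul_zero, add_zero, integral_zero] at h
    linarith
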